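/- Let $n\ge 1$. For $m\ge 0$ let $Q_m$ denote the $m$-dimensional hypercube graph, whose vertices are the subsets of $[m]=\{1,\dots,m\}$, with $X$ and $Y$ adjacent if and only if $X\oplus Y=\{i\}$ for some $i\in[m]$, where $\oplus$ is symmetric difference; $i$ is then called the direction of the edge $\{X,Y\}$. For $i\in[n]$ let $\sigma_i$ be the automorphism $X\mapsto X\oplus\{i\}$ of $Q_n$. The signature of a spanning tree $T$ of $Q_n$ is the $n$-tuple $(a_1,\dots,a_n)$ in which $a_i$ is the number of edges of $T$ in direction $i$. A spanning tree $T'$ of $Q_n$ is obtained from a spanning tree $T$ by an edge slide if there are $i\in[n]$ and an edge $e$ of $T$ in a direction $j\neq i$ such that $\sigma_i(e)$ is not an edge of $T$ and $T'=T-e+\sigma_i(e)$. For an $n$-tuple $\mathcal S$, let $\mathcal E(\mathcal S)$ be the graph whose vertices are the spanning trees of $Q_n$ with signature $\mathcal S$, two of them being adjacent if and only if one is obtained from the other by a single edge slide. Then, for the signature $\mathcal S=(1,2,4,\dots,2^{n-1})$, there is an isomorphism of graphs $$\mathcal E\bigl(1,2,4,\dots,2^{n-1}\bigr)\;\cong\;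 Q_{2^n-n-1}.$$ -/

import Mathlib

open scoped symmDiff

namespace CubeTrees

/-- The `n`-cube `Q_n`: the vertices are the subsets of the `n`-element set `Fin n`, and two
vertices are adjacent iff they differ by adding or removing exactly one element. -/
def cube (n : ℕ) : SimpleGraph (Finset (Fin n)) where
  Adj X Y := ∃ i, X ∆ Y = {i}
  symm := ⟨fun X Y ⟨i, h⟩ => ⟨i, by rw [symmDiff_comm, h]⟩⟩
  loopless := ⟨fun X ⟨i, h⟩ => by simp at h⟩

/-- The edge `e = {X, Y}` has direction `i`: `X ∆ Y = {i}`. -/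
def HasDirection {n : ℕ} (e : Sym2 (Finset (Fin n))) (i : Fin n) : Prop :=
  ∃ X Y, e = s(X, Y) ∧ X ∆ Y = {i}

/-- The map `σ_i` on vertices of the cube, `X ↦ X ∆ {i}`. -/
def flip {n : ℕ} (i : Fin n) (X : Finset (Fin n)) : Finset (Fin n) := X ∆ {i}

/-- The map induced by `σ_i` on unordered pairs of vertices. -/
def flipEdge {n : ℕ} (i : Fin n) (e : Sym2 (Finset (Fin n))) : Sym2 (Finset (Fin n)) :=
  e.map (flip i)

/-- The spanning trees of `Q_n`: the trees on the whole vertex set of `Q_n` all of whose edges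
are edges of `Q_n`. -/
abbrev SpanningTree (n : ℕ) : Type :=
  {T : SimpleGraph (Finset (Fin n)) // T ≤ cube n ∧ T.IsTree}

/-- The signature of a spanning tree: its `i`-th entry is the number of edges in direction `i`. -/
noncomputable def sig {n : ℕ} (T : SpanningTree n) : Fin n → ℕ :=
  fun i => {e | e ∈ T.1.edgeSet ∧ HasDirection e i}.ncard

/-- The spanning tree `T'` is obtained from the spanning tree `T` by a single edge slide: for some
edge `e` of `T` in a direction `j ≠ i` with `σ_i(e)` not in `T`, one has `T' = T - e + σ_i(e)`. -/
def IsEdgeSlide {n : ℕ} (T T' : SpanningTree n) : Prop :=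
  ∃ (i j : Fin n) (e : Sym2 (Finset (Fin n))), j ≠ i ∧ e ∈ T.1.edgeSet ∧ HasDirection e j ∧
    flipEdge i e ∉ T.1.edgeSet ∧ T'.1.edgeSet = insert (flipEdge i e) (T.1.edgeSet \ {e})

theorem flip_flip {n : ℕ} (i : Fin n) (X : Finset (Fin n)) : flip i (flip i X) = X := by
  simp [flip]

theorem flipEdge_flipEdge {n : ℕ} (i : Fin n) (e : Sym2 (Finset (Fin n))) :
    flipEdge i (flipEdge i e) = e := by
  induction e with
  | _ X Y => simp [flipEdge, flip_flip]

theorem HasDirection.flipEdge {n : ℕ} {e : Sym2 (Finset (Fin n))} {j : Fin n}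
    (h : HasDirection e j) (i : Fin n) : HasDirection (flipEdge i e) j := by
  obtain ⟨X, Y, rfl, h⟩ := h
  refine ⟨flip i X, flip i Y, by simp [CubeTrees.flipEdge], ?_⟩
  rw [flip, flip, symmDiff_symmDiff_symmDiff_comm, symmDiff_self, symmDiff_bot, h]

/-- The edge slide graph of `Q_n`: the vertices are the spanning trees of `Q_n`, and two are
adjacent iff one is obtained from the other by a single edge slide. -/
def edgeSlideGraph (n : ℕ) : SimpleGraph (SpanningTree n) where
  Adj := IsEdgeSlide
  symm := ⟨by
    rintro T T' ⟨i, j, e, hij, he, hd, hn, hT⟩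
    have hne : e ≠ flipEdge i e := fun h => hn (h ▸ he)
    refine ⟨i, j, flipEdge i e, hij, by simp [hT], hd.flipEdge i, ?_, ?_⟩
    · rw [flipEdge_flipEdge, hT]
      simp [hne]
    · rw [flipEdge_flipEdge, hT]
      ext f
      simp only [Set.mem_insert_iff, Set.mem_sdiff, Set.mem_singleton_iff]
      grind⟩
  loopless := ⟨by
    rintro T ⟨i, j, e, hij, he, hd, hn, hT⟩
    exact hn (hT ▸ Set.mem_insert _ _)⟩

/-- The edge slide graph of the `n`-tuple `S`: the subgraph of the edge slide graph of `Q_n`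
induced by the spanning trees with signature `S`. -/
def edgeSlideGraphOfSig {n : ℕ} (S : Fin n → ℕ) : SimpleGraph {T : SpanningTree n // sig T = S} :=
  (edgeSlideGraph n).induce {T | sig T = S}

/-- The supersaturated signature `(1, 2, 4, …, 2^(n-1))`; the index `i : Fin n` starts at `0`. -/
def supersat (n : ℕ) : Fin n → ℕ := fun i => 2 ^ (i : ℕ)

end CubeTrees

open scoped symmDiff

namespace CubeTrees

/-! Give an edge of direction `j` the position `(j, X)`, where `X` is the trace of its endpoints on
the indices below `j`. A tree with this signature has exactly one edge at each position. Contracting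
directions above `j`, and also direction `j` except over `X`, leaves `2 ^ j + 1` points. If no edge
lay at `(j, X)`, these would have to be joined by the `2 ^ j - 1` edges of smaller directions
(`exists_adj_over`). Uniqueness follows by counting (`eq_of_adj_over`).

Only the coordinates above `j` of each edge remain free. Any choice of them gives a tree
(`slotGraph_isTree`), so these trees correspond to sets of slots. A slide in a direction below `j`
would change the position, while one above `j` toggles exactly one slot
(`isEdgeSlide_slotTree_iff`). The number of slots is the dimension of the cube (`card_slot`). -/

/-! ### Contraction of connected graphs -/

theorem connected_map_of_surjective {V W : Type*} {G : SimpleGraph V} (hG : G.Connected)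
    {f : V → W} (hf : Function.Surjective f) : (G.map f).Connected := by
  have := hG.nonempty.map f
  have key : ∀ u v, G.Reachable u v → (G.map f).Reachable (f u) (f v) := by
    rintro u v ⟨p⟩
    induction p with
    | nil => rfl
    | @cons u v w h _ ih =>
      refine SimpleGraph.Reachable.trans ?_ ih
      by_cases huv : f u = f v
      · rw [huv]
      · exact SimpleGraph.Adj.reachable ⟨huv, u, v, h, rfl, rfl⟩
  refine ⟨fun a b => ?_⟩
  obtain ⟨u, rfl⟩ := hf a
  obtain ⟨v, rfl⟩ := hf b
  exact key u v (hG.preconnected u v)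

/-- The image graph is connected, and each of its edges comes from an edge of `G` that `f` does not
collapse. -/
theorem card_le_ncard_nondiag_add_one {V W : Type*} [Finite V] {G : SimpleGraph V}
    (hG : G.Connected) {f : V → W} (hf : Function.Surjective f) :
    Nat.card W ≤ {e | e ∈ G.edgeSet ∧ ¬ (e.map f).IsDiag}.ncard + 1 := by
  refine (connected_map_of_surjective hG hf).card_vert_le_card_edgeSet_add_one.trans ?_
  rw [Nat.card_coe_set_eq]
  gcongr
  refine (Set.ncard_le_ncard ?_ (Set.toFinite _)).trans
    (Set.ncard_image_le (f := Sym2.map f) (Set.toFinite _))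
  rintro ⟨a, b⟩ ⟨hab, u, v, huv, rfl, rfl⟩
  exact ⟨s(u, v), ⟨huv, by simpa using hab⟩, rfl⟩

/-! ### Directions of edges in the cube -/

variable {n : ℕ}

theorem mem_flip {i j : Fin n} {X : Finset (Fin n)} :
    i ∈ flip j X ↔ (i ∈ X ∧ i ≠ j ∨ i = j ∧ i ∉ X) := by
  simp [flip, Finset.mem_symmDiff]

theorem mem_flip_self {j : Fin n} {X : Finset (Fin n)} : j ∈ flip j X ↔ j ∉ X := by
  simp [mem_flip]

theorem mem_flip_of_ne {i j : Fin n} (h : i ≠ j) {X : Finset (Fin n)} :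
    i ∈ flip j X ↔ i ∈ X := by
  simp [mem_flip, h]

theorem symmDiff_eq_singleton_iff {X Y : Finset (Fin n)} {j : Fin n} :
    X ∆ Y = {j} ↔ Y = flip j X := by
  constructor
  · intro h; rw [flip, ← h, symmDiff_symmDiff_cancel_left]
  · rintro rfl; simp [flip]

theorem flip_comm (i j : Fin n) (X : Finset (Fin n)) : flip i (flip j X) = flip j (flip i X) := by
  simp only [flip, symmDiff_assoc, symmDiff_comm {j}]

theorem flip_left_injective {i j : Fin n} {X : Finset (Fin n)} (h : flip i X = flip j X) :
    i = j := by
  simpa [flip] using h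

theorem hasDirection_mk {X Y : Finset (Fin n)} {j : Fin n} :
    HasDirection s(X, Y) j ↔ Y = flip j X := by
  constructor
  · rintro ⟨A, B, h, hd⟩
    rw [symmDiff_eq_singleton_iff] at hd
    subst hd
    rcases Sym2.eq_iff.1 h with ⟨rfl, rfl⟩ | ⟨rfl, rfl⟩
    · rfl
    · rw [flip_flip]
  · rintro rfl
    exact ⟨X, _, rfl, by simp [flip]⟩

theorem exists_hasDirection {G : SimpleGraph (Finset (Fin n))} (hG : G ≤ cube n)
    {e : Sym2 (Finset (Fin n))} (he : e ∈ G.edgeSet) : ∃ j, HasDirection e j := by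
  induction e with
  | _ X Y =>
    obtain ⟨j, hj⟩ := hG he
    exact ⟨j, X, Y, rfl, hj⟩

/-- An edge in direction `j` has a unique endpoint which does not contain `j`. -/
theorem HasDirection.exists_notMem {e : Sym2 (Finset (Fin n))} {j : Fin n}
    (h : HasDirection e j) : ∃ Y, j ∉ Y ∧ e = s(Y, flip j Y) := by
  induction e with
  | _ X Y =>
    rw [hasDirection_mk] at h
    subst h
    by_cases hj : j ∈ X
    · exact ⟨flip j X, by simpa [mem_flip_self] using hj, by rw [flip_flip, Sym2.eq_swap]⟩
    · exact ⟨X, hj, rfl⟩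

theorem edge_injective {i j : Fin n} {X Y : Finset (Fin n)} (hX : i ∉ X) (hY : j ∉ Y)
    (h : s(X, flip i X) = s(Y, flip j Y)) : i = j ∧ X = Y := by
  rcases Sym2.eq_iff.1 h with ⟨rfl, h⟩ | ⟨rfl, h⟩
  · exact ⟨flip_left_injective h, rfl⟩
  · rw [flip_comm] at h
    have hij : i = j := by
      by_contra hne
      have := congrArg (j ∈ ·) h
      have hji : j ≠ i := fun h => hne h.symm
      simp [mem_flip_self, mem_flip_of_ne hji, hY] at this
    subst hij
    exact absurd (mem_flip_self.2 hY) hX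

theorem ncard_direction (G : SimpleGraph (Finset (Fin n))) (j : Fin n) :
    {e | e ∈ G.edgeSet ∧ HasDirection e j}.ncard = {Y | j ∉ Y ∧ G.Adj Y (flip j Y)}.ncard := by
  have hinj : Set.InjOn (fun Y => s(Y, flip j Y)) {Y | j ∉ Y ∧ G.Adj Y (flip j Y)} :=
    fun X hX Y hY h => (edge_injective hX.1 hY.1 h).2
  rw [← hinj.ncard_image]
  congr 1
  ext e
  constructor
  · rintro ⟨he, hd⟩
    obtain ⟨Y, hj, rfl⟩ := hd.exists_notMem
    exact ⟨Y, ⟨hj, he⟩, rfl⟩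
  · rintro ⟨Y, ⟨hj, hY⟩, rfl⟩
    exact ⟨hY, hasDirection_mk.2 rfl⟩

/-- The bound is `1 + 2 + ⋯ + 2 ^ (k - 1) = 2 ^ k - 1`. It serves both for a given tree and for
showing that `slotGraph` has few enough edges. -/
theorem ncard_direction_lt {G : SimpleGraph (Finset (Fin n))}
    (h : ∀ j : Fin n, {e | e ∈ G.edgeSet ∧ HasDirection e j}.ncard = 2 ^ (j : ℕ))
    (k : ℕ) (hk : k ≤ n) :
    {e | e ∈ G.edgeSet ∧ ∃ j : Fin n, (j : ℕ) < k ∧ HasDirection e j}.ncard < 2 ^ k := by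
  induction k with
  | zero => simp
  | succ k ih =>
    have hsub : {e | e ∈ G.edgeSet ∧ ∃ j : Fin n, (j : ℕ) < k + 1 ∧ HasDirection e j} ⊆
        {e | e ∈ G.edgeSet ∧ ∃ j : Fin n, (j : ℕ) < k ∧ HasDirection e j} ∪
        {e | e ∈ G.edgeSet ∧ HasDirection e ⟨k, hk⟩} := by
      rintro e ⟨he, j, hj, hd⟩
      rcases Nat.lt_succ_iff_lt_or_eq.1 hj with hj | hj
      · exact Or.inl ⟨he, j, hj, hd⟩
      · obtain rfl : j = ⟨k, hk⟩ := Fin.ext hj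
        exact Or.inr ⟨he, hd⟩
    have h1 := (Set.ncard_le_ncard hsub (Set.toFinite _)).trans (Set.ncard_union_le _ _)
    rw [h ⟨k, hk⟩] at h1
    have h2 := ih (by omega)
    rw [pow_succ]
    simp only at h1
    omega

/-! ### Traces and the number of slots -/

/-- The trace of a set `Y` on the indices smaller than `j`. -/
def below (j : Fin n) (Y : Finset (Fin n)) : Finset {x : Fin n // x < j} :=
  Y.subtype (· < j)

theorem mem_below {j : Fin n} {Y : Finset (Fin n)} {x : {x : Fin n // x < j}} :
    x ∈ below j Y ↔ (x : Fin n) ∈ Y := by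
  simp [below]

theorem below_eq_iff {j : Fin n} {Y Z : Finset (Fin n)} :
    below j Y = below j Z ↔ ∀ i < j, i ∈ Y ↔ i ∈ Z := by
  simp [Finset.ext_iff, mem_below]

theorem below_flip_of_le {i j : Fin n} (h : j ≤ i) (Y : Finset (Fin n)) :
    below j (flip i Y) = below j Y :=
  below_eq_iff.2 fun _ hk => mem_flip_of_ne (hk.trans_le h).ne

theorem below_flip_ne {i j : Fin n} (h : i < j) (Y : Finset (Fin n)) :
    below j (flip i Y) ≠ below j Y := by
  rw [Ne, below_eq_iff]
  intro H
  have := H i h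
  rw [mem_flip_self] at this
  tauto

theorem below_map (j : Fin n) (X : Finset {x : Fin n // x < j}) :
    below j (X.map (Function.Embedding.subtype _)) = X := by
  ext x
  simpa [mem_below] using fun _ => x.2

theorem card_subtype_lt (j : Fin n) : Fintype.card {x : Fin n // x < j} = j := by
  rw [Fintype.card_subtype, Finset.filter_gt_eq_Iio, Fin.card_Iio]

theorem card_subtype_gt (j : Fin n) : Fintype.card {x : Fin n // j < x} = n - 1 - j := by
  rw [Fintype.card_subtype, Finset.filter_lt_eq_Ioi, Fin.card_Ioi]

theorem card_finset_below (j : Fin n) : Nat.card (Finset {x : Fin n // x < j}) = 2 ^ (j : ℕ) := by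
  rw [Nat.card_eq_fintype_card, Fintype.card_finset, card_subtype_lt]

/-- The slots of a tree with supersaturated signature: the edge of direction `j` lying over the
set `X` of indices below `j` may be moved freely in each direction `i > j`. -/
abbrev Slot (n : ℕ) : Type :=
  Σ j : Fin n, Finset {x : Fin n // x < j} × {i : Fin n // j < i}

theorem card_slot (n : ℕ) : Fintype.card (Slot n) = 2 ^ n - n - 1 := by
  have key : ∀ m, (∑ j : Fin m, 2 ^ (j : ℕ) * (m - 1 - (j : ℕ))) + m + 1 = 2 ^ m := by
    intro m
    induction m with
    | zero => simp
    | succ m ih =>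
      rw [Fin.sum_univ_castSucc]
      -- The new top index has no slots of its own, but gives one more slot to each lower position.
      have hs : ∀ j : Fin m, 2 ^ (j : ℕ) * (m + 1 - 1 - (j : ℕ)) =
          2 ^ (j : ℕ) * (m - 1 - (j : ℕ)) + 2 ^ (j : ℕ) := by
        intro j
        rw [show m + 1 - 1 - (j : ℕ) = m - 1 - j + 1 by omega]
        ring
      have hg : (∑ j : Fin m, 2 ^ (j : ℕ)) + 1 = 2 ^ m := by
        rw [Fin.sum_univ_eq_sum_range (fun j => 2 ^ j), Nat.geomSum_eq le_rfl]
        have := Nat.one_le_two_pow (n := m)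
        simp; omega
      simp only [Fin.val_castSucc, hs, Finset.sum_add_distrib, Fin.val_last]
      rw [pow_succ]
      simp
      omega
  have hc : Fintype.card (Slot n) = ∑ j : Fin n, 2 ^ (j : ℕ) * (n - 1 - (j : ℕ)) := by
    simp only [Fintype.card_sigma, Fintype.card_prod, Fintype.card_finset, card_subtype_lt,
      card_subtype_gt]
  have := key n
  omega

/-! ### One edge at each position -/

theorem exists_adj_over {T : SpanningTree n} (hT : sig T = supersat n) (j : Fin n)
    (X : Finset {x : Fin n // x < j}) :
    ∃ Y, j ∉ Y ∧ below j Y = X ∧ T.1.Adj Y (flip j Y) := by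
  classical
  by_contra! hno
  -- The trace map, with the fibre over `X` split in two according to membership of `j`; `none` is
  -- the extra point.
  set f : Finset (Fin n) → Option (Finset {x : Fin n // x < j}) :=
    fun Y => if below j Y = X ∧ j ∈ Y then none else some (below j Y) with hf
  have hj (Z : Finset {x : Fin n // x < j}) : j ∉ Z.map (Function.Embedding.subtype _) := by
    simp
  have hsurj : Function.Surjective f := by
    rintro (_ | Z)
    · refine ⟨flip j (X.map (Function.Embedding.subtype _)), if_pos ⟨?_, ?_⟩⟩
      · rw [below_flip_of_le le_rfl, below_map]
      · rw [mem_flip_self]; exact hj X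
    · refine ⟨Z.map (Function.Embedding.subtype _), ?_⟩
      rw [hf]
      simp only [hj, and_false, if_false, below_map]
  have hle := card_le_ncard_nondiag_add_one T.2.2.connected hsurj
  have hsub : {e | e ∈ T.1.edgeSet ∧ ¬ (e.map f).IsDiag} ⊆
      {e | e ∈ T.1.edgeSet ∧ ∃ i : Fin n, (i : ℕ) < j ∧ HasDirection e i} := by
    rintro e ⟨he, hd⟩
    refine ⟨he, ?_⟩
    obtain ⟨i, hi⟩ := exists_hasDirection T.2.1 he
    refine ⟨i, ?_, hi⟩
    by_contra! hji
    obtain ⟨Y, hY, rfl⟩ := hi.exists_notMem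
    apply hd
    have hb := below_flip_of_le (show j ≤ i from hji) Y
    simp only [Sym2.map_mk, Sym2.mk_isDiag_iff, hf, hb]
    -- An edge of direction `j` does not lie over `X`, by assumption, so it stays in an unsplit
    -- fibre. A higher direction affects neither the trace nor membership of `j`.
    by_cases hij : j = i
    · subst hij
      have hYX : below j Y ≠ X := fun h => hno Y hY h he
      simp [hYX]
    · simp [mem_flip_of_ne hij]
  have hlt := ncard_direction_lt (G := T.1) (fun j => congrFun hT j) j j.2.le
  have hle' := Set.ncard_le_ncard hsub (Set.toFinite _)
  rw [Finite.card_option, card_finset_below] at hle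
  omega

/-- The trace maps the `2 ^ j` edges of direction `j` onto the `2 ^ j` possible traces, hence
injectively. -/
theorem eq_of_adj_over {T : SpanningTree n} (hT : sig T = supersat n) {j : Fin n}
    {Y Z : Finset (Fin n)} (hY : j ∉ Y) (hZ : j ∉ Z) (hYadj : T.1.Adj Y (flip j Y))
    (hZadj : T.1.Adj Z (flip j Z)) (h : below j Y = below j Z) : Y = Z := by
  set g : {Y | j ∉ Y ∧ T.1.Adj Y (flip j Y)} → Finset {x : Fin n // x < j} :=
    fun Y => below j Y
  have hsurj : Function.Surjective g := fun X => by
    obtain ⟨Y, h1, h2, h3⟩ := exists_adj_over hT j X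
    exact ⟨⟨Y, h1, h3⟩, h2⟩
  have hcard : Nat.card {Y | j ∉ Y ∧ T.1.Adj Y (flip j Y)} ≤
      Nat.card (Finset {x : Fin n // x < j}) := by
    rw [card_finset_below, Nat.card_coe_set_eq, ← ncard_direction]
    exact (congrFun hT j).le
  have := (hsurj.bijective_of_nat_card_le hcard).1
    (a₁ := ⟨Y, hY, hYadj⟩) (a₂ := ⟨Z, hZ, hZadj⟩) h
  exact congrArg Subtype.val this

/-! ### Edges described by a set of slots -/

/-- The position of an edge: its direction `j` and the set of indices below `j` it lies over. -/
abbrev Position (n : ℕ) : Type := Σ j : Fin n, Finset {x : Fin n // x < j}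

/-- The slot of the position `p` and the direction `i`. -/
def Position.slot (p : Position n) (i : Fin n) (h : p.1 < i) : Slot n := ⟨p.1, p.2, i, h⟩

theorem Position.slot_inj {p q : Position n} {i k : Fin n} {hi : p.1 < i} {hk : q.1 < k} :
    p.slot i hi = q.slot k hk ↔ p = q ∧ i = k := by
  constructor
  · intro h
    obtain ⟨j, X⟩ := p
    obtain ⟨l, Y⟩ := q
    have h1 : j = l := congrArg Sigma.fst h
    subst h1
    simpa [Position.slot] using h
  · rintro ⟨rfl, rfl⟩
    rfl

/-- The endpoint not containing `p.1` of the edge at position `p` described by `S`. -/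
noncomputable def base (S : Finset (Slot n)) (p : Position n) : Finset (Fin n) := by
  classical
  exact {i | (∃ h : i < p.1, ⟨i, h⟩ ∈ p.2) ∨ ∃ h : p.1 < i, p.slot i h ∈ S}

variable {S S' : Finset (Slot n)} {p q : Position n} {i : Fin n}

theorem notMem_base : p.1 ∉ base S p := by
  simp [base]

theorem below_base : below p.1 (base S p) = p.2 := by
  ext ⟨x, hx⟩
  simp [base, mem_below, hx, hx.not_gt]

theorem mem_base (h : p.1 < i) : i ∈ base S p ↔ p.slot i h ∈ S := by
  simp [base, h, h.not_gt]

theorem eq_base {j : Fin n} {Y : Finset (Fin n)} (hj : j ∉ Y)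
    (h : ∀ i (hi : j < i), i ∈ Y ↔ Position.slot ⟨j, below j Y⟩ i hi ∈ S) :
    Y = base S ⟨j, below j Y⟩ := by
  ext i
  rcases lt_trichotomy i j with hi | rfl | hi
  · have := below_base (S := S) (p := ⟨j, below j Y⟩)
    exact (below_eq_iff.1 this i hi).symm
  · simp [hj, notMem_base (S := S) (p := ⟨i, below i Y⟩)]
  · rw [h i hi, mem_base]

/-- The edge at position `p` described by `S`. -/
noncomputable def edgeAt (S : Finset (Slot n)) (p : Position n) : Sym2 (Finset (Fin n)) :=
  s(base S p, flip p.1 (base S p))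

theorem hasDirection_edgeAt : HasDirection (edgeAt S p) p.1 := hasDirection_mk.2 rfl

theorem edgeAt_eq_iff : edgeAt S p = edgeAt S' q ↔ p = q ∧ base S p = base S' q := by
  constructor
  · intro h
    obtain ⟨h1, h2⟩ := edge_injective notMem_base notMem_base h
    refine ⟨?_, h2⟩
    have hp := below_base (S := S) (p := p)
    have hq := below_base (S := S') (p := q)
    obtain ⟨j, X⟩ := p
    obtain ⟨k, Y⟩ := q
    obtain rfl : j = k := h1
    rw [h2] at hp
    obtain rfl : X = Y := hp.symm.trans hq
    rfl
  · rintro ⟨rfl, h⟩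
    rw [edgeAt, edgeAt, h]

theorem flipEdge_edgeAt (i : Fin n) :
    flipEdge i (edgeAt S p) = s(flip i (base S p), flip p.1 (flip i (base S p))) := by
  rw [flip_comm p.1 i]
  rfl

theorem edgeAt_eq_flipEdge_iff (hi : p.1 ≠ i) :
    edgeAt S' p = flipEdge i (edgeAt S p) ↔ base S' p = flip i (base S p) := by
  rw [flipEdge_edgeAt]
  constructor
  · intro h
    exact (edge_injective notMem_base (by rw [mem_flip_of_ne hi]; exact notMem_base) h).2
  · intro h
    rw [edgeAt, h]

/-- The position fixes all coordinates of a base up to its direction, so bases can differ only in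
coordinates recorded by slots. -/
theorem symmDiff_eq_slot_iff (hi : p.1 < i) :
    S ∆ S' = {p.slot i hi} ↔
      base S' p = flip i (base S p) ∧ ∀ q ≠ p, base S' q = base S q := by
  have hlow (q : Position n) (k : Fin n) (hk : k < q.1) :
      k ∈ base S' q ↔ k ∈ base S q :=
    below_eq_iff.1 ((below_base (S := S') (p := q)).trans below_base.symm) k hk
  have hmem : S ∆ S' = {p.slot i hi} ↔ ∀ (q : Position n) (k : Fin n) (hk : q.1 < k),
      (q = p ∧ k = i) ↔ ¬ (k ∈ base S' q ↔ k ∈ base S q) := by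
    rw [Finset.ext_iff]
    constructor
    · intro h q k hk
      have := h (q.slot k hk)
      rw [Finset.mem_singleton, Position.slot_inj] at this
      rw [mem_base hk, mem_base hk, ← this, Finset.mem_symmDiff]
      tauto
    · rintro h ⟨j, X, k, hk⟩
      have := h ⟨j, X⟩ k hk
      rw [mem_base hk, mem_base hk, ← Position.slot_inj (hi := hk) (hk := hi)] at this
      change Position.slot ⟨j, X⟩ k hk ∈ _ ↔ Position.slot ⟨j, X⟩ k hk ∈ _
      rw [Finset.mem_singleton, this, Finset.mem_symmDiff]
      tauto
  rw [hmem]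
  constructor
  · intro h
    constructor
    · ext k
      rcases lt_trichotomy k p.1 with hk | rfl | hk
      · rw [hlow p k hk, mem_flip_of_ne (hk.trans hi).ne]
      · simp [mem_flip_of_ne hi.ne, notMem_base]
      · have := h p k hk
        by_cases hki : k = i
        · subst hki
          rw [mem_flip_self]
          tauto
        · rw [mem_flip_of_ne hki]
          tauto
    · intro q hq
      ext k
      rcases lt_trichotomy k q.1 with hk | rfl | hk
      · exact hlow q k hk
      · simp [notMem_base]
      · have := h q k hk
        tauto
  · rintro ⟨h1, h2⟩ q k hk
    by_cases hq : q = p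
    · subst hq
      rw [h1]
      by_cases hki : k = i
      · subst hki
        simp only [mem_flip_self]
        tauto
      · simp [mem_flip_of_ne hki, hki]
    · simp [h2 q hq, hq]

/-! ### The tree of a set of slots -/

/-- The graph formed by the edges described by `S`. -/
def slotGraph (S : Finset (Slot n)) : SimpleGraph (Finset (Fin n)) where
  Adj Y Z := ∃ p, s(Y, Z) = edgeAt S p
  symm := ⟨fun Y Z ⟨p, h⟩ => ⟨p, by rw [Sym2.eq_swap, h]⟩⟩
  loopless := ⟨fun Y ⟨p, h⟩ => by
    have := (h ▸ hasDirection_edgeAt : HasDirection s(Y, Y) p.1)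
    rw [hasDirection_mk] at this
    have := congrArg (p.1 ∈ ·) this
    simp [mem_flip_self] at this⟩

theorem mem_edgeSet_slotGraph {e : Sym2 (Finset (Fin n))} :
    e ∈ (slotGraph S).edgeSet ↔ ∃ p, e = edgeAt S p := by
  induction e with
  | _ Y Z => rfl

theorem slotGraph_le : slotGraph S ≤ cube n := by
  rintro Y Z ⟨p, h⟩
  exact ⟨p.1, symmDiff_eq_singleton_iff.2 (hasDirection_mk.1 (h ▸ hasDirection_edgeAt))⟩

/-- Descending induction on `k`: sets that agree below `k` but differ at `k` are joined through the
edge of direction `k` over their common trace. -/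
theorem slotGraph_reachable (k : ℕ) (hk : k ≤ n) (Y Z : Finset (Fin n))
    (h : ∀ i : Fin n, (i : ℕ) < k → (i ∈ Y ↔ i ∈ Z)) : (slotGraph S).Reachable Y Z := by
  induction hk using Nat.decreasingInduction generalizing Y Z with
  | self =>
    obtain rfl : Y = Z := by
      ext i
      exact h i i.2
    rfl
  | of_succ k hk ih =>
    set j : Fin n := ⟨k, hk⟩ with hj
    have step (A B : Finset (Fin n)) (hAB : ∀ i : Fin n, (i : ℕ) < k → (i ∈ A ↔ i ∈ B))
        (hjAB : j ∈ A ↔ j ∈ B) : (slotGraph S).Reachable A B := by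
      refine ih A B fun i hi => ?_
      rcases Nat.lt_succ_iff_lt_or_eq.1 hi with hi | hi
      · exact hAB i hi
      · obtain rfl : i = j := Fin.ext hi
        exact hjAB
    have cross (A B : Finset (Fin n)) (hAB : ∀ i : Fin n, (i : ℕ) < k → (i ∈ A ↔ i ∈ B))
        (hA : j ∉ A) (hB : j ∈ B) : (slotGraph S).Reachable A B := by
      set p : Position n := ⟨j, below j A⟩
      have hb : ∀ i < j, i ∈ base S p ↔ i ∈ A :=
        below_eq_iff.1 (below_base (S := S) (p := p))
      have hnot : j ∉ base S p := notMem_base (S := S) (p := p)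
      have hadj : (slotGraph S).Adj (base S p) (flip j (base S p)) := ⟨p, rfl⟩
      refine (step A (base S p) (fun i hi => (hb i hi).symm) (by tauto)).trans
        (hadj.reachable.trans (step _ B (fun i hi => ?_) ?_))
      · have hij : i < j := hi
        rw [mem_flip_of_ne hij.ne, hb i hij, hAB i hi]
      · rw [mem_flip_self]
        tauto
    by_cases hY : j ∈ Y <;> by_cases hZ : j ∈ Z
    · exact step Y Z h (by tauto)
    · exact (cross Z Y (fun i hi => (h i hi).symm) hZ hY).symm
    · exact cross Y Z h hY hZ
    · exact step Y Z h (by tauto)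

theorem ncard_direction_slotGraph (S : Finset (Slot n)) (j : Fin n) :
    {e | e ∈ (slotGraph S).edgeSet ∧ HasDirection e j}.ncard = 2 ^ (j : ℕ) := by
  have hrange : {e | e ∈ (slotGraph S).edgeSet ∧ HasDirection e j} =
      Set.range fun X : Finset {x : Fin n // x < j} => edgeAt S ⟨j, X⟩ := by
    ext e
    constructor
    · rintro ⟨he, hd⟩
      obtain ⟨p, rfl⟩ := mem_edgeSet_slotGraph.1 he
      obtain ⟨k, X⟩ := p
      obtain rfl : k = j := flip_left_injective (hasDirection_mk.1 hd)
      exact ⟨X, rfl⟩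
    · rintro ⟨X, rfl⟩
      exact ⟨mem_edgeSet_slotGraph.2 ⟨_, rfl⟩, hasDirection_edgeAt⟩
  have hinj : Function.Injective fun X : Finset {x : Fin n // x < j} => edgeAt S ⟨j, X⟩ := by
    intro X Y h
    simpa using (edgeAt_eq_iff.1 h).1
  rw [hrange, ← Nat.card_coe_set_eq, Nat.card_range_of_injective hinj, card_finset_below]

/-- A connected graph on `2 ^ n` vertices with fewer than `2 ^ n` edges is a tree. -/
theorem slotGraph_isTree (S : Finset (Slot n)) : (slotGraph S).IsTree := by
  have hconn : (slotGraph S).Connected :=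
    ⟨fun Y Z => slotGraph_reachable 0 (Nat.zero_le n) Y Z (by simp)⟩
  rw [SimpleGraph.isTree_iff_connected_and_card]
  refine ⟨hconn, le_antisymm ?_ hconn.card_vert_le_card_edgeSet_add_one⟩
  have hlt := ncard_direction_lt (ncard_direction_slotGraph S) n le_rfl
  have hall : {e | e ∈ (slotGraph S).edgeSet ∧ ∃ j : Fin n, (j : ℕ) < n ∧ HasDirection e j} =
      (slotGraph S).edgeSet := by
    ext e
    refine ⟨fun h => h.1, fun h => ⟨h, ?_⟩⟩
    obtain ⟨j, hj⟩ := exists_hasDirection slotGraph_le h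
    exact ⟨j, j.2, hj⟩
  rw [hall] at hlt
  simpa [Nat.card_coe_set_eq] using hlt

/-- The spanning tree with supersaturated signature described by `S`. -/
def slotTree (S : Finset (Slot n)) : {T : SpanningTree n // sig T = supersat n} :=
  ⟨⟨slotGraph S, slotGraph_le, slotGraph_isTree S⟩, funext (ncard_direction_slotGraph S)⟩

/-! ### Trees as sets of slots, slides as toggles -/

theorem base_congr_of_edgeAt_mem (h : edgeAt S' q ∈ (slotGraph S).edgeSet) :
    base S' q = base S q := by
  obtain ⟨r, hr⟩ := mem_edgeSet_slotGraph.1 h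
  obtain ⟨rfl, h⟩ := edgeAt_eq_iff.1 hr
  exact h

theorem slotTree_injective : Function.Injective (slotTree (n := n)) := by
  intro S S' h
  have hG : slotGraph S = slotGraph S' := congrArg (fun T => T.1.1) h
  ext ⟨j, X, i, hi⟩
  have hb : base S ⟨j, X⟩ = base S' ⟨j, X⟩ :=
    base_congr_of_edgeAt_mem (hG ▸ mem_edgeSet_slotGraph.2 ⟨_, rfl⟩)
  have h1 := mem_base (S := S) (p := ⟨j, X⟩) hi
  have h2 := mem_base (S := S') (p := ⟨j, X⟩) hi
  rw [hb] at h1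
  exact h1.symm.trans h2

theorem slotTree_surjective : Function.Surjective (slotTree (n := n)) := by
  classical
  rintro ⟨T, hT⟩
  choose Y hYn hYb hYa using exists_adj_over hT
  set S : Finset (Slot n) := {s | (s.2.2 : Fin n) ∈ Y s.1 s.2.1} with hS
  have hbase (p : Position n) : base S p = Y p.1 p.2 := by
    have := eq_base (S := S) (hYn p.1 p.2) (fun i hi => by
      simp [hS, Position.slot, hYb])
    rw [hYb] at this
    exact this.symm
  refine ⟨S, Subtype.ext (Subtype.ext ?_)⟩
  change slotGraph S = T.1
  rw [← SimpleGraph.edgeSet_inj]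
  ext e
  rw [mem_edgeSet_slotGraph]
  constructor
  · rintro ⟨p, rfl⟩
    rw [edgeAt, hbase]
    exact hYa p.1 p.2
  · intro he
    obtain ⟨j, hd⟩ := exists_hasDirection T.2.1 he
    obtain ⟨Z, hZ, rfl⟩ := hd.exists_notMem
    refine ⟨⟨j, below j Z⟩, ?_⟩
    rw [edgeAt, hbase]
    have := eq_of_adj_over hT hZ (hYn j (below j Z)) he (hYa _ _) (hYb _ _).symm
    rw [← this]

theorem isEdgeSlide_slotTree_iff :
    IsEdgeSlide (slotTree S).1 (slotTree S').1 ↔ ∃ s, S ∆ S' = {s} := by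
  constructor
  · rintro ⟨i, j, e, hij, he, hd, -, hT⟩
    obtain ⟨p, rfl⟩ := mem_edgeSet_slotGraph.1 he
    obtain rfl : p.1 = j := flip_left_injective (hasDirection_mk.1 hd)
    change (slotGraph S').edgeSet = insert _ ((slotGraph S).edgeSet \ _) at hT
    have hmem (q : Position n) : edgeAt S' q = flipEdge i (edgeAt S p) ∨
        base S' q = base S q ∧ q ≠ p := by
      have : edgeAt S' q ∈ (slotGraph S').edgeSet := mem_edgeSet_slotGraph.2 ⟨q, rfl⟩
      rw [hT] at this
      rcases this with h | ⟨h, hne⟩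
      · exact Or.inl h
      · have hb := base_congr_of_edgeAt_mem h
        refine Or.inr ⟨hb, ?_⟩
        rintro rfl
        exact hne (edgeAt_eq_iff.2 ⟨rfl, hb⟩)
    -- The only old edge at position `p` was removed, so the new edge must fill that position.
    have hp : edgeAt S' p = flipEdge i (edgeAt S p) := (hmem p).resolve_right fun h => h.2 rfl
    have hbp := (edgeAt_eq_flipEdge_iff hij).1 hp
    -- A smaller `i` would change the trace, whereas both bases at `p` have trace `p.2`.
    have hlt : p.1 < i := by
      by_contra! hle
      apply below_flip_ne (lt_of_le_of_ne hle hij.symm) (base S p)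
      rw [← hbp, below_base, below_base]
    refine ⟨p.slot i hlt, (symmDiff_eq_slot_iff hlt).2 ⟨hbp, fun q hq => ?_⟩⟩
    rcases hmem q with h | h
    · exact absurd (edgeAt_eq_iff.1 (h.trans hp.symm)).1 hq
    · exact h.1
  · rintro ⟨⟨j, X, i, hi⟩, h⟩
    obtain ⟨p, hpj⟩ : ∃ p : Position n, p = ⟨j, X⟩ := ⟨_, rfl⟩
    obtain ⟨hbp, hb⟩ := (symmDiff_eq_slot_iff (p := ⟨j, X⟩) hi).1 h
    rw [← hpj] at hbp hb
    replace hi : p.1 < i := hpj ▸ hi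
    have hp := (edgeAt_eq_flipEdge_iff (p := p) (ne_of_lt hi)).2 hbp
    have hq (q : Position n) (hqp : q ≠ p) : edgeAt S' q = edgeAt S q :=
      edgeAt_eq_iff.2 ⟨rfl, hb q hqp⟩
    refine ⟨i, p.1, edgeAt S p, ne_of_lt hi, mem_edgeSet_slotGraph.2 ⟨p, rfl⟩,
      hasDirection_edgeAt, ?_, ?_⟩
    -- If the slid edge were already present, the two bases at `p` would coincide, yet they differ
    -- at `i`.
    · intro hmem
      rw [← hp] at hmem
      have := base_congr_of_edgeAt_mem hmem
      rw [hbp] at this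
      have := congrArg (i ∈ ·) this
      simp [mem_flip_self] at this
    · change (slotGraph S').edgeSet = insert _ ((slotGraph S).edgeSet \ _)
      ext e
      simp only [Set.mem_insert_iff, Set.mem_sdiff, Set.mem_singleton_iff, mem_edgeSet_slotGraph]
      constructor
      · rintro ⟨q, rfl⟩
        by_cases hqp : q = p
        · exact Or.inl (hqp ▸ hp)
        · rw [hq q hqp]
          exact Or.inr ⟨⟨q, rfl⟩, fun h => hqp (edgeAt_eq_iff.1 h).1⟩
      · rintro (rfl | ⟨⟨q, rfl⟩, hne⟩)
        · exact ⟨p, hp.symm⟩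
        · exact ⟨q, (hq q fun h => hne (h ▸ rfl)).symm⟩

end CubeTrees

theorem corollary6p9 (n : ℕ) (hn : 1 ≤ n) :
    Nonempty (CubeTrees.edgeSlideGraphOfSig (CubeTrees.supersat n) ≃g
      CubeTrees.cube (2 ^ n - n - 1)) := by
  classical
  let ε : CubeTrees.Slot n ≃ Fin (2 ^ n - n - 1) :=
    Fintype.equivFinOfCardEq (CubeTrees.card_slot n)
  let φ := Equiv.ofBijective _ ⟨CubeTrees.slotTree_injective (n := n),
    CubeTrees.slotTree_surjective⟩
  refine ⟨SimpleGraph.Iso.symm ⟨ε.symm.finsetCongr.trans φ, ?_⟩⟩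
  intro A B
  change CubeTrees.IsEdgeSlide (CubeTrees.slotTree (A.map _)).1
    (CubeTrees.slotTree (B.map _)).1 ↔ ∃ i, A ∆ B = {i}
  rw [CubeTrees.isEdgeSlide_slotTree_iff]
  have hmap : A.map ε.symm.toEmbedding ∆ B.map ε.symm.toEmbedding =
      (A ∆ B).map ε.symm.toEmbedding := by
    ext s
    simp [Finset.mem_symmDiff]
  change (∃ s, A.map ε.symm.toEmbedding ∆ B.map ε.symm.toEmbedding = {s}) ↔ _
  rw [hmap]
  constructor
  · rintro ⟨s, hs⟩
    refine ⟨ε s, Finset.map_injective ε.symm.toEmbedding ?_⟩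
    simpa using hs
  · rintro ⟨i, hi⟩
    exact ⟨ε.symm i, by simp [hi]⟩
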